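/- Let $k$ be a field, let $\Gamma$ be a finite group, and let $R$ be a Hopf algebra in the braided category of left Yetter--Drinfeld modules over the group algebra $k\Gamma$, with coaction $\delta:R\to k\Gamma\otimes R$, $\delta(r)=r_{(-1)}\otimes r_{(0)}$. Suppose that $R$ is an ET-algebra: its coradical (the sum of its simple subcoalgebras) is $k1$, and $R$ is generated as an algebra by the space of its primitive elements $P(R)=\{r\in R\mid \Delta(r)=1\otimes r+r\otimes 1\}$. Suppose further that, as a Yetter--Drinfeld module, $P(R)\cong M(g,\rho)$ for some $g\in\Gamma$ and some irreducible representation $\rho$ of the centralizer $\Gamma_g$ on a space $V$. Here $M(g,\rho)=k\Gamma\otimes_{k\Gamma_g}V$ with action $h(x\otimes v)=hx\otimes v$ and coaction $\delta(x\otimes v)=xgx^{-1}\otimes(x\otimes v)$. Let $G$ be the subgroup of $\Gamma$ generated by the conjugacy class of $g$; it is normal. Then $\delta(R)\subseteq kG\otimes R$, and with the restricted action, this coaction and the same multiplication, comultiplication and antipode, $R$ is a Hopf algebra in the category of Yetter--Drinfeld modules over $kG$. The bosonization $R\#k\Gamma$ (the Hopf algebra $R\otimes k\Gamma$ with $(r\#x)(s\#y)=r(x\cdot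 s)\#xy$ and $\Delta(r\#x)=\big(r_{(1)}\#(r_{(2)})_{(-1)}x\big)\otimes\big((r_{(2)})_{(0)}\#x\big)$ for $x,y\in\Gamma$) is an extension of the bosonization $R\#kG$ by the group algebra $k(\Gamma/G)$. That is, the maps $$\iota:R\#kG\to R\#k\Gamma,\quad \iota(r\#x)=r\#x,\qquad \pi:R\#k\Gamma\to k(\Gamma/G),\quad \pi(r\#x)=\varepsilon(r)\,xG,$$ are Hopf algebra morphisms forming an exact sequence $k\to R\#kG\to R\#k\Gamma\to k(\Gamma/G)\to k$: $\iota$ is injective, $\pi$ is surjective, and, writing $B=R\#k\Gamma$, $A=\iota(R\#kG)$ and $A^+=A\cap\ker\varepsilon$, one has $\ker\pi=BA^+=A^+B$ and $$A=\{b\in B\mid(\pi\otimes\mathrm{id})\Delta(b)=1\otimes b\}=\{b\in B\mid(\mathrm{id}\otimes\pi)\Delta(b)=b\otimes 1\}.$$ -/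

import Mathlib

open TensorProduct
open scoped MonoidAlgebra

noncomputable section

namespace BraidedHopf

section GroupTensor

variable {k Γ M N : Type*} [Field k] [AddCommGroup M] [Module k M]
  [AddCommGroup N] [Module k N]

/-- The linear map `kΓ ⊗ M → N` with `x ⊗ m ↦ f x m` for `x` in the group `Γ`. -/
def groupLift (f : Γ → M →ₗ[k] N) : k[Γ] ⊗[k] M →ₗ[k] N :=
  TensorProduct.lift
    (Finsupp.linearCombination k f ∘ₗ (MonoidAlgebra.coeffLinearEquiv k).toLinearMap)

@[simp]
theorem groupLift_single (f : Γ → M →ₗ[k] N) (x : Γ) (a : k) (m : M) :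
    groupLift f (MonoidAlgebra.single x a ⊗ₜ[k] m) = a • f x m := by
  simp [groupLift]

theorem tensor_induction {p : k[Γ] ⊗[k] M → Prop} (z : k[Γ] ⊗[k] M)
    (add : ∀ a b, p a → p b → p (a + b)) (zero : p 0)
    (tmul : ∀ x m, p (MonoidAlgebra.single x (1 : k) ⊗ₜ[k] m)) : p z := by
  induction z using TensorProduct.induction_on with
  | zero => exact zero
  | add a b ha hb => exact add a b ha hb
  | tmul h m =>
    induction h using MonoidAlgebra.induction_linear with
    | zero => simpa using zero
    | add a b ha hb => rw [TensorProduct.add_tmul]; exact add _ _ ha hb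
    | single x a =>
      have : (MonoidAlgebra.single x a : k[Γ]) = a • MonoidAlgebra.single x 1 := by simp
      rw [this, TensorProduct.smul_tmul]
      exact tmul x _

/-- `h ↦ x h x⁻¹` on the group algebra. -/
def conj (k : Type*) {Γ : Type*} [Field k] [Group Γ] (x : Γ) : k[Γ] →ₗ[k] k[Γ] :=
  LinearMap.mulLeft k (MonoidAlgebra.single x 1) ∘ₗ
    LinearMap.mulRight k (MonoidAlgebra.single x⁻¹ 1)

@[simp]
theorem conj_single [Group Γ] (x y : Γ) (a : k) :
    conj k x (MonoidAlgebra.single y a) = MonoidAlgebra.single (x * y * x⁻¹) a := by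
  simp [conj, mul_assoc]

end GroupTensor

/-- A left Yetter--Drinfeld module structure over the group algebra `kΓ` on a vector space `M`:
an action of `Γ` (that is, a `kΓ`-module structure), a left `kΓ`-comodule structure
`δ : M → kΓ ⊗ M`, and the compatibility `δ(x m) = x m₍₋₁₎ x⁻¹ ⊗ x m₍₀₎` for `x ∈ Γ`. -/
structure YetterDrinfeld (k Γ M : Type*) [Field k] [Group Γ] [AddCommGroup M] [Module k M] where
  act : Representation k Γ M
  coact : M →ₗ[k] k[Γ] ⊗[k] M
  coact_coassoc : (TensorProduct.assoc k k[Γ] k[Γ] M).toLinearMap ∘ₗ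
    (Coalgebra.comul (R := k) (A := k[Γ])).rTensor M ∘ₗ coact = coact.lTensor k[Γ] ∘ₗ coact
  coact_counit : (TensorProduct.lid k M).toLinearMap ∘ₗ
    (Coalgebra.counit (R := k) (A := k[Γ])).rTensor M ∘ₗ coact = LinearMap.id
  coact_act : ∀ x : Γ, coact ∘ₗ act x = TensorProduct.map (conj k x) (act x) ∘ₗ coact

namespace YetterDrinfeld

variable {k Γ M N : Type*} [Field k] [Group Γ] [AddCommGroup M] [Module k M]
  [AddCommGroup N] [Module k N]

/-- Morphisms of Yetter--Drinfeld modules: linear maps that are equivariant and colinear. -/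
structure IsHom (X : YetterDrinfeld k Γ M) (Y : YetterDrinfeld k Γ N) (f : M →ₗ[k] N) :
    Prop where
  map_act : ∀ x : Γ, f ∘ₗ X.act x = Y.act x ∘ₗ f
  map_coact : Y.coact ∘ₗ f = f.lTensor k[Γ] ∘ₗ X.coact

/-- The codiagonal coaction on `M ⊗ N`: `m ⊗ n ↦ m₍₋₁₎ n₍₋₁₎ ⊗ (m₍₀₎ ⊗ n₍₀₎)`. -/
def tensorCoact (X : YetterDrinfeld k Γ M) (Y : YetterDrinfeld k Γ N) :
    M ⊗[k] N →ₗ[k] k[Γ] ⊗[k] (M ⊗[k] N) :=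
  (LinearMap.mul' k k[Γ]).rTensor (M ⊗[k] N) ∘ₗ
    (TensorProduct.tensorTensorTensorComm k k[Γ] M k[Γ] N).toLinearMap ∘ₗ
    TensorProduct.map X.coact Y.coact

/-- The braiding `c(m ⊗ n) = m₍₋₁₎ n ⊗ m₍₀₎`. -/
def braiding (X : YetterDrinfeld k Γ M) (Y : YetterDrinfeld k Γ N) :
    M ⊗[k] N →ₗ[k] N ⊗[k] M :=
  groupLift (fun g => (Y.act g).rTensor M ∘ₗ (TensorProduct.comm k M N).toLinearMap) ∘ₗ
    (TensorProduct.assoc k k[Γ] M N).toLinearMap ∘ₗ X.coact.rTensor N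

end YetterDrinfeld

/-- A Hopf algebra in the braided category of Yetter--Drinfeld modules over `kΓ`, on the space `R`
carrying a given (associative, unital) algebra and (coassociative, counital) coalgebra structure:
a Yetter--Drinfeld structure for which the unit, multiplication, counit and comultiplication are
morphisms, the bialgebra axioms with respect to the braiding, and an antipode which is a morphism.
The tensor product carries the diagonal action and the codiagonal coaction, the unit object `k` the
trivial ones. -/
structure BraidedHopfAlgebra (k Γ R : Type*) [Field k] [Group Γ] [Ring R] [Algebra k R]
    [Coalgebra k R] extends YetterDrinfeld k Γ R where
  act_one : ∀ x : Γ, act x 1 = 1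
  coact_one : coact 1 = 1 ⊗ₜ[k] 1
  act_mul : ∀ (x : Γ) (r s : R), act x (r * s) = act x r * act x s
  coact_mul : coact ∘ₗ LinearMap.mul' k R =
    (LinearMap.mul' k R).lTensor k[Γ] ∘ₗ toYetterDrinfeld.tensorCoact toYetterDrinfeld
  counit_act : ∀ (x : Γ) (r : R), Coalgebra.counit (R := k) (act x r) = Coalgebra.counit (R := k) r
  counit_coact : ∀ r : R, (Coalgebra.counit (R := k) (A := R)).lTensor k[Γ] (coact r) =
    1 ⊗ₜ[k] Coalgebra.counit (R := k) r
  comul_act : ∀ x : Γ, Coalgebra.comul (R := k) ∘ₗ act x =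
    TensorProduct.map (act x) (act x) ∘ₗ Coalgebra.comul (R := k)
  comul_coact : (Coalgebra.comul (R := k) (A := R)).lTensor k[Γ] ∘ₗ coact =
    toYetterDrinfeld.tensorCoact toYetterDrinfeld ∘ₗ Coalgebra.comul (R := k)
  counit_one : Coalgebra.counit (R := k) (1 : R) = 1
  counit_mul : ∀ r s : R, Coalgebra.counit (R := k) (r * s) =
    Coalgebra.counit (R := k) r * Coalgebra.counit (R := k) s
  comul_one : Coalgebra.comul (R := k) (1 : R) = 1 ⊗ₜ[k] 1
  /-- `Δ m = (m ⊗ m)(id ⊗ c ⊗ id)(Δ ⊗ Δ)` -/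
  comul_mul : Coalgebra.comul (R := k) ∘ₗ LinearMap.mul' k R =
    TensorProduct.map (LinearMap.mul' k R) (LinearMap.mul' k R) ∘ₗ
      (TensorProduct.assoc k R R (R ⊗[k] R)).symm.toLinearMap ∘ₗ
      ((TensorProduct.assoc k R R R).toLinearMap ∘ₗ
        (toYetterDrinfeld.braiding toYetterDrinfeld).rTensor R ∘ₗ
        (TensorProduct.assoc k R R R).symm.toLinearMap).lTensor R ∘ₗ
      (TensorProduct.assoc k R R (R ⊗[k] R)).toLinearMap ∘ₗ
      TensorProduct.map (Coalgebra.comul (R := k)) (Coalgebra.comul (R := k))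
  antipode : R →ₗ[k] R
  antipode_hom : toYetterDrinfeld.IsHom toYetterDrinfeld antipode
  antipode_left : LinearMap.mul' k R ∘ₗ antipode.rTensor R ∘ₗ Coalgebra.comul (R := k) =
    Algebra.linearMap k R ∘ₗ Coalgebra.counit (R := k)
  antipode_right : LinearMap.mul' k R ∘ₗ antipode.lTensor R ∘ₗ Coalgebra.comul (R := k) =
    Algebra.linearMap k R ∘ₗ Coalgebra.counit (R := k)

/-- The space `P(R)` of primitive elements. -/
def primitives (k R : Type*) [Field k] [Ring R] [Algebra k R] [Coalgebra k R] : Submodule k R where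
  carrier := {r | Coalgebra.comul (R := k) r = 1 ⊗ₜ[k] r + r ⊗ₜ[k] 1}
  add_mem' {a b} ha hb := by
    simp only [Set.mem_ofPred_eq] at *
    rw [map_add, ha, hb, TensorProduct.tmul_add, TensorProduct.add_tmul]
    abel
  zero_mem' := by simp
  smul_mem' c a ha := by
    simp only [Set.mem_ofPred_eq] at *
    rw [map_smul, ha, smul_add, TensorProduct.tmul_smul, ← TensorProduct.smul_tmul']

/-- A subspace `C` of a coalgebra with `Δ(C) ⊆ C ⊗ C`. -/
def IsSubcoalgebra {k R : Type*} [Field k] [AddCommGroup R] [Module k R] [Coalgebra k R]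
    (C : Submodule k R) : Prop :=
  ∀ c ∈ C, Coalgebra.comul (R := k) c ∈ LinearMap.range (TensorProduct.map C.subtype C.subtype)

/-- A nonzero subcoalgebra without subcoalgebras other than `0` and itself. -/
def IsSimpleSubcoalgebra {k R : Type*} [Field k] [AddCommGroup R] [Module k R] [Coalgebra k R]
    (C : Submodule k R) : Prop :=
  IsSubcoalgebra C ∧ C ≠ ⊥ ∧ ∀ C' : Submodule k R, IsSubcoalgebra C' → C' ≤ C → C' = ⊥ ∨ C' = C

/-- The coradical: the sum of all simple subcoalgebras. -/
def coradical (k R : Type*) [Field k] [AddCommGroup R] [Module k R] [Coalgebra k R] :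
    Submodule k R :=
  sSup {C | IsSimpleSubcoalgebra C}

namespace BraidedHopfAlgebra

variable {k Γ R : Type*} [Field k] [Group Γ] [Ring R] [Algebra k R] [Coalgebra k R]

/-- The underlying space `R ⊗ kΓ = ⨁_{x ∈ Γ} R ⊗ x` of the bosonization `R # kΓ`;
the element `r # x` is `Finsupp.single x r`. -/
def Bosonization (_D : BraidedHopfAlgebra k Γ R) : Type _ := Γ →₀ R

variable (D : BraidedHopfAlgebra k Γ R)

instance : AddCommGroup D.Bosonization := inferInstanceAs (AddCommGroup (Γ →₀ R))

instance : Module k D.Bosonization := inferInstanceAs (Module k (Γ →₀ R))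

/-- `r ↦ r # x` -/
def smash (x : Γ) : R →ₗ[k] D.Bosonization := Finsupp.lsingle (M := R) (R := k) x

/-- Linear maps on `R # kΓ` given on each summand `R # x`. -/
def bosonLift {N : Type*} [AddCommGroup N] [Module k N] (f : Γ → R →ₗ[k] N) :
    D.Bosonization →ₗ[k] N :=
  Finsupp.lsum k (M := R) f

@[simp]
theorem bosonLift_smash {N : Type*} [AddCommGroup N] [Module k N] (f : Γ → R →ₗ[k] N) (x : Γ)
    (r : R) : D.bosonLift f (D.smash x r) = f x r := by
  change Finsupp.lsum k (M := R) f (Finsupp.single x r) = f x r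
  simp

@[ext high]
theorem boson_hom_ext {N : Type*} [AddCommGroup N] [Module k N] {f g : D.Bosonization →ₗ[k] N}
    (h : ∀ x, f ∘ₗ D.smash x = g ∘ₗ D.smash x) : f = g :=
  Finsupp.lhom_ext' (M := R) h

/-- Multiplication of `R # kΓ`: `(r # x)(s # y) = r (x s) # x y`. -/
def bosonMul : D.Bosonization →ₗ[k] D.Bosonization →ₗ[k] D.Bosonization :=
  D.bosonLift fun x => (D.bosonLift fun y =>
    (((LinearMap.mul k R).compl₂ (D.act x)).compr₂ (D.smash (x * y))).flip).flip

instance : Mul D.Bosonization := ⟨fun a b => D.bosonMul a b⟩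

instance : One D.Bosonization := ⟨D.smash 1 1⟩

theorem boson_mul_def (a b : D.Bosonization) : a * b = D.bosonMul a b := rfl

theorem boson_one_def : (1 : D.Bosonization) = D.smash 1 1 := rfl

@[simp]
theorem smash_mul_smash (x y : Γ) (r s : R) :
    D.smash x r * D.smash y s = D.smash (x * y) (r * D.act x s) := by
  simp [boson_mul_def, bosonMul]

theorem boson_induction {p : D.Bosonization → Prop} (a : D.Bosonization) (zero : p 0)
    (add : ∀ a b, p a → p b → p (a + b)) (smash : ∀ x r, p (D.smash x r)) : p a :=
  Finsupp.induction_linear (M := R) a zero add smash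

instance : Ring D.Bosonization :=
  { (inferInstance : AddCommGroup D.Bosonization), (inferInstance : Mul D.Bosonization),
    (inferInstance : One D.Bosonization) with
    left_distrib := fun a b c => map_add (D.bosonMul a) b c
    right_distrib := fun a b c => by simp [boson_mul_def]
    zero_mul := fun a => by simp [boson_mul_def]
    mul_zero := fun a => by simp [boson_mul_def]
    one_mul := fun a => by
      have : D.bosonMul 1 = LinearMap.id := by
        ext x r
        simp [boson_one_def, ← boson_mul_def]
      simp [boson_mul_def, this]
    mul_one := fun a => by
      have : D.bosonMul.flip 1 = LinearMap.id := by
        ext x r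
        simp [boson_one_def, ← boson_mul_def, D.act_one]
      rw [boson_mul_def, ← LinearMap.flip_apply, this, LinearMap.id_apply]
    mul_assoc := fun a b c => by
      simp only [boson_mul_def]
      induction a using D.boson_induction with
      | zero => simp
      | add a a' h h' => simp [h, h']
      | smash x r =>
      induction b using D.boson_induction with
      | zero => simp
      | add a a' h h' => simp [h, h']
      | smash y s =>
      induction c using D.boson_induction with
      | zero => simp
      | add a a' h h' => simp [h, h']
      | smash z t => simp [← boson_mul_def, D.act_mul, mul_assoc] }

instance : Algebra k D.Bosonization :=
  Algebra.ofModule (fun a b c => by simp [boson_mul_def]) (fun a b c => by simp [boson_mul_def])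

/-- Comultiplication of `R # kΓ`:
`Δ(r # x) = (r₍₁₎ # (r₍₂₎)₍₋₁₎ x) ⊗ ((r₍₂₎)₍₀₎ # x)`. -/
def bosonComul : D.Bosonization →ₗ[k] D.Bosonization ⊗[k] D.Bosonization :=
  D.bosonLift fun x =>
    groupLift (fun g => TensorProduct.map (D.smash (g * x)) (D.smash x)) ∘ₗ
      (TensorProduct.leftComm k R k[Γ] R).toLinearMap ∘ₗ
      D.coact.lTensor R ∘ₗ Coalgebra.comul (R := k)

/-- Counit of `R # kΓ`: `ε(r # x) = ε(r)`. -/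
def bosonCounit : D.Bosonization →ₗ[k] k := D.bosonLift fun _ => Coalgebra.counit (R := k)

/-- Antipode of `R # kΓ`: `S(r # x) = (1 # x⁻¹)(1 # (r₍₋₁₎)⁻¹)(S(r₍₀₎) # 1)`. -/
def bosonAntipode : D.Bosonization →ₗ[k] D.Bosonization :=
  D.bosonLift fun x =>
    groupLift (fun g => D.smash (x⁻¹ * g⁻¹) ∘ₗ D.act (x⁻¹ * g⁻¹) ∘ₗ D.antipode) ∘ₗ D.coact

/-- The homogeneous component of degree `g`. -/
def comp (g : Γ) : R →ₗ[k] R :=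
  open Classical in groupLift (fun h => if h = g then LinearMap.id else 0) ∘ₗ D.coact

theorem coact_eq [Fintype Γ] (r : R) :
    D.coact r = ∑ g, MonoidAlgebra.single g (1 : k) ⊗ₜ[k] D.comp g r := by
  classical
  simp only [comp, LinearMap.comp_apply]
  generalize D.coact r = z
  induction z using tensor_induction with
  | zero => simp
  | add a b ha hb => simp only [map_add, TensorProduct.tmul_add, Finset.sum_add_distrib, ← ha, ← hb]
  | tmul x m => 
    rw [Finset.sum_eq_single x]
    · simp
    · intro b _ hb
      simp [hb.symm]
    · simp

theorem coeff_ext [Fintype Γ] {N : Type*} [AddCommGroup N] [Module k N] {f g : Γ → N}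
    (h : ∑ x, MonoidAlgebra.single x (1 : k) ⊗ₜ[k] f x =
      ∑ x, MonoidAlgebra.single x (1 : k) ⊗ₜ[k] g x) (x : Γ) : f x = g x := by
  classical
  have := congrArg (groupLift (k := k) (M := N) (fun y => if y = x then LinearMap.id else 0)) h
  have e : ∀ (v : Γ → N) (y : Γ), (if y = x then LinearMap.id else 0 : N →ₗ[k] N) (v y) =
      if y = x then v y else 0 := fun v y => by split <;> rfl
  simpa [e] using this

theorem groupLift_coact [Fintype Γ] {N : Type*} [AddCommGroup N] [Module k N]
    (f : Γ → R →ₗ[k] N) (r : R) : groupLift f (D.coact r) = ∑ g, f g (D.comp g r) := by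
  simp [coact_eq]

theorem comp_comp [Fintype Γ] [DecidableEq Γ] (g h : Γ) (r : R) :
    D.comp g (D.comp h r) = if g = h then D.comp h r else 0 := by
  have := LinearMap.congr_fun D.coact_coassoc r
  simp only [LinearMap.comp_apply, coact_eq, map_sum, LinearMap.rTensor_tmul,
    LinearMap.lTensor_tmul, MonoidAlgebra.comul_single] at this
  simp at this
  have h1 := coeff_ext (k := k) this h
  have h2 : ∑ u, MonoidAlgebra.single u (1 : k) ⊗ₜ[k] (if u = h then D.comp h r else 0) =
      ∑ u, MonoidAlgebra.single u (1 : k) ⊗ₜ[k] D.comp u (D.comp h r) := by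
    rw [← h1, Finset.sum_eq_single h]
    · simp
    · intro b _ hb
      simp [hb]
    · simp
  exact (coeff_ext (k := k) h2 g).symm

theorem sum_comp [Fintype Γ] (r : R) : ∑ g, D.comp g r = r := by
  have := LinearMap.congr_fun D.coact_counit r
  simpa [coact_eq] using this

theorem comp_act (g x : Γ) (r : R) :
    D.comp g (D.act x r) = D.act x (D.comp (x⁻¹ * g * x) r) := by
  classical
  have := LinearMap.congr_fun (D.coact_act x) r
  simp only [LinearMap.comp_apply] at this
  simp only [comp, LinearMap.comp_apply, this]
  generalize D.coact r = z
  induction z using tensor_induction with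
  | zero => simp
  | add a b ha hb => simp only [map_add, ha, hb]
  | tmul y m =>
    have : x * y * x⁻¹ = g ↔ y = x⁻¹ * g * x := by
      constructor
      · rintro rfl; group
      · rintro rfl; group
    by_cases h : y = x⁻¹ * g * x
    · simp only [TensorProduct.map_tmul, conj_single, groupLift_single, one_smul, if_pos h,
        if_pos (this.2 h), LinearMap.id_apply]
    · simp [this, h]

theorem tensorCoact_eq [Fintype Γ] (z : R ⊗[k] R) :
    D.tensorCoact D.toYetterDrinfeld z = ∑ g, MonoidAlgebra.single g (1 : k) ⊗ₜ[k]
      ∑ u, TensorProduct.map (D.comp u) (D.comp (u⁻¹ * g)) z := by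
  induction z using TensorProduct.induction_on with
  | zero => simp
  | add a b ha hb =>
    simp only [map_add, ha, hb, Finset.sum_add_distrib, TensorProduct.tmul_add]
  | tmul a b =>
    simp only [YetterDrinfeld.tensorCoact, LinearMap.comp_apply, TensorProduct.map_tmul, coact_eq,
      TensorProduct.sum_tmul, TensorProduct.tmul_sum, map_sum, LinearEquiv.coe_coe,
      TensorProduct.tensorTensorTensorComm_tmul, LinearMap.rTensor_tmul, LinearMap.mul'_apply,
      MonoidAlgebra.single_mul_single, mul_one]
    rw [Finset.sum_comm' (t' := Finset.univ) (s' := fun _ => Finset.univ) (by simp)]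
    conv_rhs => rw [Finset.sum_comm]
    refine Finset.sum_congr rfl fun u _ => ?_
    conv_rhs => rw [← Equiv.sum_comp (Equiv.mulLeft u)]
    simp

theorem comp_mul [Fintype Γ] (g : Γ) (r s : R) :
    D.comp g (r * s) = ∑ u, D.comp u r * D.comp (u⁻¹ * g) s := by
  have := LinearMap.congr_fun D.coact_mul (r ⊗ₜ s)
  simp only [LinearMap.comp_apply, tensorCoact_eq, coact_eq, map_sum, LinearMap.lTensor_tmul,
    LinearMap.mul'_apply, TensorProduct.map_tmul] at this
  exact coeff_ext (k := k) this g

theorem comp_one [Fintype Γ] [DecidableEq Γ] (g : Γ) : D.comp g 1 = if g = 1 then 1 else 0 := by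
  have : ∑ u, MonoidAlgebra.single u (1 : k) ⊗ₜ[k] D.comp u 1 =
      ∑ u, MonoidAlgebra.single u (1 : k) ⊗ₜ[k] (if u = 1 then (1 : R) else 0) := by
    rw [← coact_eq, D.coact_one, Finset.sum_eq_single 1]
    · simp [MonoidAlgebra.one_def]
    · intro b _ hb
      simp [hb]
    · simp
  exact coeff_ext (k := k) this g

theorem comul_comp [Fintype Γ] (g : Γ) (r : R) :
    Coalgebra.comul (R := k) (D.comp g r) =
      ∑ u, TensorProduct.map (D.comp u) (D.comp (u⁻¹ * g)) (Coalgebra.comul (R := k) r) := by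
  have := LinearMap.congr_fun D.comul_coact r
  simp only [LinearMap.comp_apply, tensorCoact_eq, coact_eq, map_sum, LinearMap.lTensor_tmul] at this
  exact coeff_ext (k := k) this g

theorem counit_comp [Fintype Γ] [DecidableEq Γ] (g : Γ) (r : R) :
    Coalgebra.counit (R := k) (D.comp g r) = if g = 1 then Coalgebra.counit (R := k) r else 0 := by
  have := D.counit_coact r
  simp only [coact_eq, map_sum, LinearMap.lTensor_tmul] at this
  have h2 : ∑ u, MonoidAlgebra.single u (1 : k) ⊗ₜ[k] Coalgebra.counit (R := k) (D.comp u r) =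
      ∑ u, MonoidAlgebra.single u (1 : k) ⊗ₜ[k]
        (if u = 1 then Coalgebra.counit (R := k) r else 0) := by
    rw [this, Finset.sum_eq_single 1]
    · simp [MonoidAlgebra.one_def]
    · intro b _ hb
      simp [hb]
    · simp
  exact coeff_ext (k := k) h2 g

theorem antipode_comp [Fintype Γ] (g : Γ) (r : R) :
    D.antipode (D.comp g r) = D.comp g (D.antipode r) := by
  have := LinearMap.congr_fun D.antipode_hom.map_coact r
  simp only [LinearMap.comp_apply, coact_eq, map_sum, LinearMap.lTensor_tmul] at this
  exact (coeff_ext (k := k) this g).symm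

theorem bosonComul_smash [Fintype Γ] (x : Γ) (r : R) :
    D.bosonComul (D.smash x r) = ∑ g,
      TensorProduct.map (D.smash (g * x)) (D.smash x ∘ₗ D.comp g) (Coalgebra.comul (R := k) r) := by
  simp only [bosonComul, bosonLift_smash, LinearMap.comp_apply]
  generalize Coalgebra.comul (R := k) r = z
  induction z using TensorProduct.induction_on with
  | zero => simp
  | add a b ha hb => simp only [map_add, ha, hb, Finset.sum_add_distrib]
  | tmul a b => simp [coact_eq, TensorProduct.tmul_sum]

theorem comul_mul_apply [Fintype Γ] (r s : R) :
    Coalgebra.comul (R := k) (r * s) =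
      ∑ g, TensorProduct.map₂ (LinearMap.mul k R) (LinearMap.mul k R)
        (TensorProduct.map LinearMap.id (D.comp g) (Coalgebra.comul (R := k) r))
        (TensorProduct.map (D.act g) LinearMap.id (Coalgebra.comul (R := k) s)) := by
  have := LinearMap.congr_fun D.comul_mul (r ⊗ₜ s)
  simp only [LinearMap.comp_apply, LinearMap.mul'_apply, TensorProduct.map_tmul] at this
  rw [this]
  generalize Coalgebra.comul (R := k) r = z
  generalize Coalgebra.comul (R := k) s = w
  induction z using TensorProduct.induction_on with
  | zero => simp
  | add a b ha hb => simp only [map_add, LinearMap.add_apply, ha, hb, Finset.sum_add_distrib,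
      TensorProduct.add_tmul]
  | tmul a b =>
  induction w using TensorProduct.induction_on with
  | zero => simp
  | add a b ha hb => simp only [map_add, ha, hb, Finset.sum_add_distrib, TensorProduct.tmul_add]
  | tmul c d =>
    simp [YetterDrinfeld.braiding, coact_eq, TensorProduct.sum_tmul, TensorProduct.tmul_sum]

theorem boson_coassoc [Fintype Γ] :
    (TensorProduct.assoc k D.Bosonization D.Bosonization D.Bosonization).toLinearMap ∘ₗ
      D.bosonComul.rTensor D.Bosonization ∘ₗ D.bosonComul =
    D.bosonComul.lTensor D.Bosonization ∘ₗ D.bosonComul := by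
  classical
  ext x r
  simp only [LinearMap.comp_apply, bosonComul_smash]
  let A : R ⊗[k] (R ⊗[k] R) →ₗ[k]
      D.Bosonization ⊗[k] (D.Bosonization ⊗[k] D.Bosonization) :=
    ∑ v, ∑ u, TensorProduct.map (D.smash (u * (v * x)))
      (TensorProduct.map (D.smash (v * x) ∘ₗ D.comp u) (D.smash x ∘ₗ D.comp v))
  have hL : ∀ z : R ⊗[k] R,
      TensorProduct.assoc k D.Bosonization D.Bosonization D.Bosonization
        (D.bosonComul.rTensor D.Bosonization
          (∑ g, TensorProduct.map (D.smash (g * x)) (D.smash x ∘ₗ D.comp g) z)) =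
      A (TensorProduct.assoc k R R R ((Coalgebra.comul (R := k)).rTensor R z)) := by
    intro z
    induction z using TensorProduct.induction_on with
    | zero => simp
    | add a b ha hb => simp only [map_add, Finset.sum_add_distrib, ha, hb]
    | tmul a b =>
      simp only [TensorProduct.map_tmul, map_sum, LinearMap.rTensor_tmul, bosonComul_smash]
      generalize Coalgebra.comul (R := k) a = w
      induction w using TensorProduct.induction_on with
      | zero => simp
      | add a b ha hb =>
        simp only [map_add, TensorProduct.add_tmul, Finset.sum_add_distrib, ha, hb]
      | tmul c d => simp [A, TensorProduct.sum_tmul]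
  have hR : ∀ z : R ⊗[k] R,
      D.bosonComul.lTensor D.Bosonization
          (∑ g, TensorProduct.map (D.smash (g * x)) (D.smash x ∘ₗ D.comp g) z) =
      A ((Coalgebra.comul (R := k)).lTensor R z) := by
    intro z
    induction z using TensorProduct.induction_on with
    | zero => simp
    | add a b ha hb => simp only [map_add, Finset.sum_add_distrib, ha, hb]
    | tmul a b =>
      simp only [TensorProduct.map_tmul, map_sum, LinearMap.lTensor_tmul, LinearMap.comp_apply,
        bosonComul_smash, comul_comp]
      generalize Coalgebra.comul (R := k) b = w
      induction w using TensorProduct.induction_on with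
      | zero => simp
      | add a b ha hb =>
        simp only [map_add, TensorProduct.tmul_add, Finset.sum_add_distrib, ha, hb]
      | tmul c d =>
        simp only [TensorProduct.map_tmul, LinearMap.comp_apply, comp_comp, A,
          LinearMap.sum_apply, TensorProduct.tmul_sum, apply_ite (D.smash x), map_zero,
          TensorProduct.tmul_ite]
        rw [Finset.sum_comm]
        refine Finset.sum_congr rfl fun h _ => ?_
        rw [Finset.sum_comm]
        refine Finset.sum_congr rfl fun u _ => ?_
        rw [Finset.sum_eq_single (u * h)]
        · simp [mul_assoc]
        · intro g _ hg
          rw [if_neg]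
          rintro rfl
          simp at hg
        · simp
  rw [LinearEquiv.coe_coe, hL, hR, Coalgebra.coassoc_apply]

instance [Finite Γ] : Coalgebra k D.Bosonization where
  comul := D.bosonComul
  counit := D.bosonCounit
  coassoc := by
    have := Fintype.ofFinite Γ
    exact D.boson_coassoc
  rTensor_counit_comp_comul := by
    have := Fintype.ofFinite Γ
    ext x r
    simp only [LinearMap.comp_apply, bosonComul_smash]
    have h : ∀ z : R ⊗[k] R, D.bosonCounit.rTensor D.Bosonization
        (∑ g, TensorProduct.map (D.smash (g * x)) (D.smash x ∘ₗ D.comp g) z) =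
        (D.smash x).lTensor k ((Coalgebra.counit (R := k)).rTensor R z) := by
      intro z
      induction z using TensorProduct.induction_on with
      | zero => simp
      | add a b ha hb => simp only [map_add, Finset.sum_add_distrib, ha, hb]
      | tmul a b =>
        simp only [bosonCounit, map_sum, TensorProduct.map_tmul, LinearMap.rTensor_tmul,
          LinearMap.comp_apply, bosonLift_smash, LinearMap.lTensor_tmul]
        rw [← TensorProduct.tmul_sum, ← map_sum, sum_comp]
    rw [h]
    simp
  lTensor_counit_comp_comul := by
    classical
    have := Fintype.ofFinite Γ
    ext x r
    simp only [LinearMap.comp_apply, bosonComul_smash]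
    have h : ∀ z : R ⊗[k] R, D.bosonCounit.lTensor D.Bosonization
        (∑ g, TensorProduct.map (D.smash (g * x)) (D.smash x ∘ₗ D.comp g) z) =
        (D.smash x).rTensor k ((Coalgebra.counit (R := k)).lTensor R z) := by
      intro z
      induction z using TensorProduct.induction_on with
      | zero => simp
      | add a b ha hb => simp only [map_add, Finset.sum_add_distrib, ha, hb]
      | tmul a b =>
        simp only [bosonCounit, map_sum, TensorProduct.map_tmul, LinearMap.lTensor_tmul,
          LinearMap.comp_apply, bosonLift_smash, counit_comp, LinearMap.rTensor_tmul]
        rw [Finset.sum_eq_single 1]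
        · simp
        · intro b _ hb
          simp [hb]
        · simp
    rw [h]
    simp

theorem boson_comul_def [Finite Γ] (a : D.Bosonization) :
    Coalgebra.comul (R := k) a = D.bosonComul a := rfl

theorem boson_counit_def [Finite Γ] (a : D.Bosonization) :
    Coalgebra.counit (R := k) a = D.bosonCounit a := rfl

instance [Finite Γ] : Bialgebra k D.Bosonization :=
  Bialgebra.mk' k D.Bosonization
    (by simp [boson_counit_def, bosonCounit, boson_one_def, D.counit_one])
    (by
      intro a b
      simp only [boson_counit_def]
      induction a using D.boson_induction with
      | zero => simp
      | add a a' h h' => simp [add_mul, h, h']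
      | smash x r =>
      induction b using D.boson_induction with
      | zero => simp
      | add a a' h h' => simp [mul_add, h, h']
      | smash y s => simp [bosonCounit, D.counit_mul, D.counit_act])
    (by
      classical
      have := Fintype.ofFinite Γ
      simp only [boson_comul_def, boson_one_def, bosonComul_smash, D.comul_one,
        TensorProduct.map_tmul, LinearMap.comp_apply, comp_one]
      rw [Finset.sum_eq_single 1]
      · simp [Algebra.TensorProduct.one_def, boson_one_def]
      · intro b _ hb
        simp [hb]
      · simp)
    (by
      classical
      have := Fintype.ofFinite Γ
      intro a b
      simp only [boson_comul_def]
      induction a using D.boson_induction with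
      | zero => simp
      | add a a' h h' => simp [add_mul, h, h']
      | smash x r =>
      induction b using D.boson_induction with
      | zero => simp
      | add a a' h h' => simp [mul_add, h, h']
      | smash y s =>
        have hx := LinearMap.congr_fun (D.comul_act x) s
        simp only [LinearMap.comp_apply] at hx
        simp only [smash_mul_smash, bosonComul_smash, D.comul_mul_apply, hx]
        generalize Coalgebra.comul (R := k) r = z
        generalize Coalgebra.comul (R := k) s = w
        induction z using TensorProduct.induction_on with
        | zero => simp
        | add a b ha hb => simp only [map_add, LinearMap.add_apply, ha, hb, Finset.sum_add_distrib,
            add_mul]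
        | tmul a b =>
        induction w using TensorProduct.induction_on with
        | zero => simp
        | add a b ha hb => simp only [map_add, ha, hb, Finset.sum_add_distrib, mul_add]
        | tmul c d =>
          simp only [TensorProduct.map_tmul, TensorProduct.map₂_apply_tmul, LinearMap.comp_apply,
            LinearMap.id_apply, LinearMap.mul_apply', map_sum, Finset.sum_mul_sum,
            Algebra.TensorProduct.tmul_mul_tmul, smash_mul_smash, comp_mul, comp_comp,
            ite_mul, zero_mul, comp_act]
          rw [Finset.sum_comm]
          refine Finset.sum_congr rfl fun g _ => ?_
          rw [← Equiv.sum_comp ((Equiv.mulLeft (g * x)).trans (Equiv.mulRight x⁻¹))]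
          refine Finset.sum_congr rfl fun h _ => ?_
          rw [Finset.sum_eq_single g]
          · simp [mul_assoc]
          · intro b _ hb
            simp [hb]
          · simp)

theorem bosonAntipode_smash [Fintype Γ] (x : Γ) (r : R) :
    D.bosonAntipode (D.smash x r) =
      ∑ g, D.smash (x⁻¹ * g⁻¹) (D.act (x⁻¹ * g⁻¹) (D.antipode (D.comp g r))) := by
  simp [bosonAntipode, groupLift_coact]

instance [Finite Γ] : HopfAlgebra k D.Bosonization where
  antipode := D.bosonAntipode
  mul_antipode_rTensor_comul := by
    classical
    have := Fintype.ofFinite Γ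
    ext x r
    simp only [LinearMap.comp_apply, boson_comul_def, bosonComul_smash]
    have h : ∀ z : R ⊗[k] R, LinearMap.mul' k D.Bosonization (D.bosonAntipode.rTensor _
        (∑ g, TensorProduct.map (D.smash (g * x)) (D.smash x ∘ₗ D.comp g) z)) =
        ∑ u, D.smash (x⁻¹ * u⁻¹ * x) (D.act (x⁻¹ * u⁻¹) (LinearMap.mul' k R (D.antipode.rTensor R
          (∑ h, TensorProduct.map (D.comp h) (D.comp (h⁻¹ * u)) z)))) := by
      intro z
      induction z using TensorProduct.induction_on with
      | zero => simp
      | add a b ha hb => simp only [map_add, Finset.sum_add_distrib, ha, hb]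
      | tmul a b =>
        simp only [map_sum, TensorProduct.map_tmul, LinearMap.rTensor_tmul,
          LinearMap.comp_apply, bosonAntipode_smash, LinearMap.mul'_apply, Finset.sum_mul,
          smash_mul_smash, D.act_mul]
        rw [Finset.sum_comm]
        conv_rhs => rw [Finset.sum_comm]
        refine Finset.sum_congr rfl fun h _ => ?_
        conv_rhs => rw [← Equiv.sum_comp (Equiv.mulLeft h)]
        simp [mul_assoc]
    rw [h]
    have h2 : ∀ u, LinearMap.mul' k R (D.antipode.rTensor R (Coalgebra.comul (R := k)
        (D.comp u r))) = algebraMap k R (Coalgebra.counit (R := k) (D.comp u r)) :=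
      fun u => LinearMap.congr_fun D.antipode_left (D.comp u r)
    simp only [← comul_comp, h2, counit_comp]
    rw [Finset.sum_eq_single 1]
    · simp [Algebra.algebraMap_eq_smul_one, D.act_one, boson_counit_def, bosonCounit,
        boson_one_def]
    · intro b _ hb
      simp [hb]
    · simp
  mul_antipode_lTensor_comul := by
    classical
    have := Fintype.ofFinite Γ
    ext x r
    simp only [LinearMap.comp_apply, boson_comul_def, bosonComul_smash]
    have h : ∀ z : R ⊗[k] R, LinearMap.mul' k D.Bosonization (D.bosonAntipode.lTensor _
        (∑ g, TensorProduct.map (D.smash (g * x)) (D.smash x ∘ₗ D.comp g) z)) =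
        D.smash 1 (LinearMap.mul' k R (D.antipode.lTensor R z)) := by
      intro z
      induction z using TensorProduct.induction_on with
      | zero => simp
      | add a b ha hb => simp only [map_add, Finset.sum_add_distrib, ha, hb]
      | tmul a b =>
        simp only [map_sum, TensorProduct.map_tmul, LinearMap.lTensor_tmul,
          LinearMap.comp_apply, bosonAntipode_smash, LinearMap.mul'_apply, Finset.mul_sum,
          smash_mul_smash, comp_comp]
        conv_rhs => rw [← D.sum_comp b, map_sum, Finset.mul_sum, map_sum]
        refine Finset.sum_congr rfl fun g _ => ?_
        rw [Finset.sum_eq_single g]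
        · simp [mul_assoc]
        · intro h _ hh
          simp [hh]
        · simp
    rw [h]
    have h2 : LinearMap.mul' k R (D.antipode.lTensor R (Coalgebra.comul (R := k) r)) =
        algebraMap k R (Coalgebra.counit (R := k) r) :=
      LinearMap.congr_fun D.antipode_right r
    simp [h2, Algebra.algebraMap_eq_smul_one, boson_counit_def, bosonCounit, boson_one_def]

/-- `R` is an ET-algebra: the coradical is `k 1` and the primitive elements generate `R`. -/
structure IsETAlgebra (_D : BraidedHopfAlgebra k Γ R) : Prop where
  coradical_eq : coradical k R = Submodule.span k {(1 : R)}
  adjoin_primitives : Algebra.adjoin k (primitives k R : Set R) = ⊤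

/-- The braided Hopf algebra structures `E` over `kG` and `D` over `kΓ` on `R` agree, for a subgroup
`G` of `Γ`: the action of `D` restricts to that of `E`, the coaction of `D` takes values in
`kG ⊗ R` and is that of `E`, and the antipodes are equal. -/
structure IsRestriction {G : Subgroup Γ} (E : BraidedHopfAlgebra k G R)
    (D : BraidedHopfAlgebra k Γ R) : Prop where
  act_eq : ∀ x : G, E.act x = D.act (x : Γ)
  coact_eq : D.coact =
    (MonoidAlgebra.mapDomainBialgHom k G.subtype : k[G] →ₗ[k] k[Γ]).rTensor R ∘ₗ E.coact
  antipode_eq : E.antipode = D.antipode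

end BraidedHopfAlgebra

section Induced

variable {k Γ V : Type*} [Field k] [Group Γ] [AddCommGroup V] [Module k V]

/-- The centralizer `Γ_g` of `g`. -/
abbrev isotropy (g : Γ) : Subgroup Γ := Subgroup.centralizer {g}

variable (g : Γ) (ρ : Representation k (isotropy g) V)

/-- The space `kΓ ⊗_{kΓ_g} V` induced from `Γ_g` to `Γ`. In Mathlib's model the class of `x ⊗ v` is
`IndV.mk x⁻¹ v`. -/
abbrev IndSpace : Type _ := Representation.IndV (isotropy g).subtype ρ

/-- The class of `x ⊗ v` in `kΓ ⊗_{kΓ_g} V`. -/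
def indMk (x : Γ) : V →ₗ[k] IndSpace g ρ := Representation.IndV.mk (isotropy g).subtype ρ x⁻¹

theorem indMk_mul (x : Γ) (z : isotropy g) (v : V) :
    indMk g ρ (x * z) v = indMk g ρ x (ρ z v) := by
  have := Representation.Coinvariants.mk_self_apply
    (Representation.tprod ((Representation.leftRegular k Γ).comp (isotropy g).subtype) ρ) z
    (MonoidAlgebra.single (x * z)⁻¹ (1 : k) ⊗ₜ[k] v)
  simpa [indMk] using this.symm

theorem ind_hom_ext {N : Type*} [AddCommGroup N] [Module k N] {f f' : IndSpace g ρ →ₗ[k] N}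
    (h : ∀ x, f ∘ₗ indMk g ρ x = f' ∘ₗ indMk g ρ x) : f = f' :=
  Representation.IndV.hom_ext _ _ fun x => by simpa [indMk] using h x⁻¹

/-- The coaction `δ(x ⊗ v) = x g x⁻¹ ⊗ (x ⊗ v)`. -/
def indCoact : IndSpace g ρ →ₗ[k] k[Γ] ⊗[k] IndSpace g ρ :=
  Representation.Coinvariants.lift _
    (groupLift fun x => TensorProduct.mk k k[Γ] (IndSpace g ρ)
      (MonoidAlgebra.single (x⁻¹ * g * x) 1) ∘ₗ indMk g ρ x⁻¹)
    (by
      intro z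
      ext h v
      have hz : (z : Γ)⁻¹ * g * z = g := by
        have h1 := Subgroup.mem_centralizer_singleton_iff.1 z.2
        rw [mul_assoc, ← h1, inv_mul_cancel_left]
      have := indMk_mul g ρ (h⁻¹ * (z : Γ)⁻¹) z v
      have e : (h⁻¹ * (z : Γ)⁻¹ * g * (z * h) : Γ) = h⁻¹ * g * h := by
        conv_rhs => rw [← hz]
        group
      simp_all [mul_assoc])

theorem indCoact_mk (x : Γ) (v : V) : indCoact g ρ (indMk g ρ x v) =
    MonoidAlgebra.single (x * g * x⁻¹) 1 ⊗ₜ[k] indMk g ρ x v := by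
  simp [indCoact, indMk]

theorem ind_act_mk (h x : Γ) (v : V) :
    Representation.ind (isotropy g).subtype ρ h (indMk g ρ x v) = indMk g ρ (h * x) v := by
  simp [indMk]

/-- The Yetter--Drinfeld module `M(g, ρ) = kΓ ⊗_{kΓ_g} V` over `kΓ`, with
`h (x ⊗ v) = h x ⊗ v` and `δ(x ⊗ v) = x g x⁻¹ ⊗ (x ⊗ v)`. -/
def inducedYD : YetterDrinfeld k Γ (IndSpace g ρ) where
  act := Representation.ind (isotropy g).subtype ρ
  coact := indCoact g ρ
  coact_coassoc := by
    refine ind_hom_ext g ρ fun x => ?_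
    ext v
    simp [indCoact_mk]
  coact_counit := by
    refine ind_hom_ext g ρ fun x => ?_
    ext v
    simp [indCoact_mk]
  coact_act y := by
    refine ind_hom_ext g ρ fun x => ?_
    ext v
    simp only [LinearMap.comp_apply, ind_act_mk, indCoact_mk, TensorProduct.map_tmul, conj_single]
    congr 2
    group

/-- The subgroup generated by the conjugacy class of `g`. -/
def conjSubgroup (g : Γ) : Subgroup Γ := Subgroup.closure (conjugatesOf g)

instance conjSubgroup_normal (g : Γ) : (conjSubgroup g).Normal := by
  have : conjSubgroup g = Subgroup.normalClosure {g} := by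
    simp [conjSubgroup, Subgroup.normalClosure, Group.conjugatesOfSet]
  rw [this]
  infer_instance

end Induced

/-- Exactness of a sequence `k → A → B → C → k` of Hopf algebras, that is, `B` is an extension of
`A` by `C`: `ι` is injective, `π` is surjective, `ker π` is `B ι(A)⁺ = ι(A)⁺ B`, and `ι(A)` is the
space of left, and of right, `C`-coinvariants of `B`. -/
structure IsExactHopfSequence {k A B C : Type*} [Field k] [Ring A] [Ring B] [Ring C]
    [HopfAlgebra k A] [HopfAlgebra k B] [HopfAlgebra k C] (ι : A →ₐc[k] B) (π : B →ₐc[k] C) :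
    Prop where
  injective : Function.Injective ι
  surjective : Function.Surjective π
  ker_eq_left : LinearMap.ker (π : B →ₗ[k] C) =
    Submodule.span k {c | ∃ (b : B) (a : A), Coalgebra.counit (R := k) a = 0 ∧ c = b * ι a}
  ker_eq_right : LinearMap.ker (π : B →ₗ[k] C) =
    Submodule.span k {c | ∃ (b : B) (a : A), Coalgebra.counit (R := k) a = 0 ∧ c = ι a * b}
  range_eq_left : ∀ b : B, b ∈ Set.range ι ↔
    (π : B →ₗ[k] C).rTensor B (Coalgebra.comul (R := k) b) = 1 ⊗ₜ[k] b
  range_eq_right : ∀ b : B, b ∈ Set.range ι ↔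
    (π : B →ₗ[k] C).lTensor B (Coalgebra.comul (R := k) b) = b ⊗ₜ[k] 1

end BraidedHopf
end

open TensorProduct
open scoped MonoidAlgebra

noncomputable section

namespace BraidedHopf

/-! A coaction of kΓ on R is a Γ-grading, with `comp x` the projection onto degree x. The space M(g,
ρ) lives in the degrees xgx⁻¹, hence so do the primitive elements. Degrees multiply in products and
G is a subgroup, so the algebra they generate has no component of degree outside G
(`isSupportedOn_conjSubgroup`). Sums of components over Γ therefore collapse to sums over G
(`sum_subgroup`), and the axioms over kΓ become axioms over kG (`restrict`).

For exactness, put B = R#kΓ, the direct sum of the R#x. The left legs of Δ(r#x) have group part in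
Gx = xG and the right legs have group part x. Hence (π⊗id)Δ(r#x) = xG⊗(r#x) and (id⊗π)Δ(r#x) =
(r#x)⊗xG (`quotientLinearMap_rTensor_comul`, `quotientLinearMap_lTensor_comul`). So Δ makes B a
Γ/G-graded space, the same from both sides, and the coinvariants are the part over the trivial
coset, the sum of R#x with x in G, which is A. The first formula also shows that π is
comultiplicative.

For the kernel, modulo BA⁺ or A⁺B the element r#x becomes ε(r)(1#x), and 1#x depends only on xG.
Thus b is congruent to sπ(b) for a linear section s (`sub_quotientSection_mem`), which puts ker π
inside. The reverse inclusion holds because π is trivial on A (`quotientMap_incl`). -/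

theorem sum_subgroup {Γ N : Type*} [Group Γ] [AddCommMonoid N] [Fintype Γ] (G : Subgroup Γ)
    [Fintype G] (f : Γ → N) (hf : ∀ x, x ∉ G → f x = 0) : ∑ x : G, f x = ∑ x, f x := by
  classical
  rw [← Finset.sum_subset (Finset.subset_univ (Finset.univ.filter (· ∈ G)))
    (fun x _ hx => hf x (by simpa using hx))]
  exact (Finset.sum_subtype _ (by simp) f).symm

theorem conj_mem_conjSubgroup {Γ : Type*} [Group Γ] (g x : Γ) : x * g * x⁻¹ ∈ conjSubgroup g :=
  Subgroup.subset_closure (isConj_iff.2 ⟨x, rfl⟩)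

/-! ### The degrees that occur in R -/

namespace BraidedHopfAlgebra

variable {k Γ R : Type*} [Field k] [Group Γ] [Ring R] [Algebra k R] [Coalgebra k R]
  (D : BraidedHopfAlgebra k Γ R)

/-- The coaction of `D` takes values in `kG ⊗ R`. -/
def IsSupportedOn (G : Subgroup Γ) : Prop := ∀ x, x ∉ G → ∀ r, D.comp x r = 0

variable {D}

/-- The sum of the homogeneous components with degree in a subgroup is a subalgebra, so it suffices
to look at generators. -/
theorem IsSupportedOn.of_adjoin [Finite Γ] {G : Subgroup Γ} {s : Set R}
    (hs : Algebra.adjoin k s = ⊤) (h : ∀ x, x ∉ G → ∀ r ∈ s, D.comp x r = 0) :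
    D.IsSupportedOn G := by
  classical
  have := Fintype.ofFinite Γ
  intro x hx r
  have hr : r ∈ Algebra.adjoin k s := hs ▸ Algebra.mem_top
  -- The degree must vary: the product case calls the hypothesis for the second factor at u⁻¹x.
  induction hr using Algebra.adjoin_induction generalizing x with
  | mem r hr => exact h x hx r hr
  | algebraMap a =>
    rw [Algebra.algebraMap_eq_smul_one, map_smul, comp_one, if_neg, smul_zero]
    rintro rfl
    exact hx G.one_mem
  | add a b _ _ ha hb => rw [map_add, ha x hx, hb x hx, add_zero]
  | mul a b _ _ ha hb =>
    rw [comp_mul]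
    refine Finset.sum_eq_zero fun u _ => ?_
    by_cases hu : u ∈ G
    · rw [hb (u⁻¹ * x) (fun hux => hx (by simpa using G.mul_mem hu hux)), mul_zero]
    · rw [ha u hu, zero_mul]

/-- If `P(R)` is isomorphic to `M(g, ρ)` and generates `R`, then the coaction takes values in
`kG ⊗ R` for the subgroup `G` generated by the conjugacy class of `g`. -/
theorem isSupportedOn_conjSubgroup [Finite Γ] {V : Type*} [AddCommGroup V] [Module k V]
    (hD : D.IsETAlgebra) {g : Γ} {ρ : Representation k (isotropy g) V}
    {φ : IndSpace g ρ →ₗ[k] R} (hφ : (inducedYD g ρ).IsHom D.toYetterDrinfeld φ)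
    (hP : LinearMap.range φ = primitives k R) : D.IsSupportedOn (conjSubgroup g) := by
  refine IsSupportedOn.of_adjoin hD.adjoin_primitives fun x hx r hr => ?_
  rw [← hP] at hr
  obtain ⟨m, rfl⟩ := hr
  suffices D.comp x ∘ₗ φ = 0 from LinearMap.congr_fun this m
  -- The induced module is spanned by the classes y⊗v, homogeneous of degree ygy⁻¹, and the colinear
  -- map φ preserves degrees.
  refine ind_hom_ext g ρ fun y => ?_
  ext v
  have h := LinearMap.congr_fun hφ.map_coact (indMk g ρ y v)
  have hne : ¬ y * g * y⁻¹ = x := by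
    rintro rfl
    exact hx (conj_mem_conjSubgroup g y)
  simp only [LinearMap.comp_apply] at h
  simp only [LinearMap.comp_apply, comp, h]
  simp [inducedYD, indCoact_mk, hne]

/-! ### Restriction of the braided Hopf algebra to a subgroup -/

variable (D) in
/-- The `kG`-coaction obtained from that of `D` by forgetting the components of degree outside
of `G`. -/
def restrictCoact [Finite Γ] (G : Subgroup Γ) : R →ₗ[k] k[G] ⊗[k] R :=
  let := Fintype.ofFinite G
  ∑ x : G, TensorProduct.mk k k[G] R (MonoidAlgebra.single x 1) ∘ₗ D.comp (x : Γ)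

variable (D) in
-- Frees the formula from the `Fintype` instance chosen inside the definition.
theorem restrictCoact_apply [Finite Γ] (G : Subgroup Γ) [Fintype G] (r : R) :
    D.restrictCoact G r = ∑ x : G, MonoidAlgebra.single x (1 : k) ⊗ₜ[k] D.comp (x : Γ) r := by
  simp only [restrictCoact, LinearMap.sum_apply, LinearMap.comp_apply, TensorProduct.mk_apply]
  congr!

/-- The Yetter--Drinfeld module over `kG` obtained by restriction. -/
def restrictYD [Finite Γ] {G : Subgroup Γ} (hG : D.IsSupportedOn G) : YetterDrinfeld k G R where
  act := D.act.comp G.subtype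
  coact := D.restrictCoact G
  coact_coassoc := by
    classical
    have := Fintype.ofFinite Γ
    ext r
    simp only [LinearMap.comp_apply, restrictCoact_apply, map_sum, LinearMap.rTensor_tmul,
      LinearMap.lTensor_tmul, comp_comp]
    refine Finset.sum_congr rfl fun x _ => ?_
    rw [Finset.sum_eq_single x]
    · simp
    · intro b _ hb
      simp [hb]
    · simp
  coact_counit := by
    classical
    have := Fintype.ofFinite Γ
    ext r
    simp only [LinearMap.comp_apply, restrictCoact_apply, map_sum, LinearMap.rTensor_tmul]
    -- Counitality says that the components in G add up to r; this is where the support condition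
    -- enters the comodule axioms.
    simpa using (sum_subgroup G (fun x => D.comp x r) fun x hx => hG x hx r).trans (D.sum_comp r)
  coact_act y := by
    classical
    have := Fintype.ofFinite Γ
    ext r
    simp only [LinearMap.comp_apply, restrictCoact_apply, map_sum, TensorProduct.map_tmul,
      conj_single, MonoidHom.comp_apply, Subgroup.subtype_apply, comp_act]
    -- Acting by y carries degree x to yxy⁻¹, so the sum is reindexed by conjugation.
    rw [← Equiv.sum_comp ((Equiv.mulLeft y).trans (Equiv.mulRight y⁻¹))]
    simp [mul_assoc]

theorem restrictYD_tensorCoact [Finite Γ] {G : Subgroup Γ} [Fintype G] (hG : D.IsSupportedOn G)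
    (z : R ⊗[k] R) :
    (restrictYD hG).tensorCoact (restrictYD hG) z = ∑ g : G, MonoidAlgebra.single g (1 : k) ⊗ₜ[k]
      ∑ u : G, TensorProduct.map (D.comp (u : Γ)) (D.comp ((u : Γ)⁻¹ * g)) z := by
  induction z using TensorProduct.induction_on with
  | zero => simp
  | add a b ha hb =>
    simp only [map_add, ha, hb, Finset.sum_add_distrib, TensorProduct.tmul_add]
  | tmul a b =>
    simp only [YetterDrinfeld.tensorCoact, LinearMap.comp_apply, TensorProduct.map_tmul,
      restrictYD, restrictCoact_apply,
      TensorProduct.sum_tmul, TensorProduct.tmul_sum, map_sum, LinearEquiv.coe_coe,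
      TensorProduct.tensorTensorTensorComm_tmul, LinearMap.rTensor_tmul, LinearMap.mul'_apply,
      MonoidAlgebra.single_mul_single, mul_one]
    rw [Finset.sum_comm' (t' := Finset.univ) (s' := fun _ => Finset.univ) (by simp)]
    conv_rhs => rw [Finset.sum_comm]
    refine Finset.sum_congr rfl fun u _ => ?_
    -- With first degree u, the total degree g corresponds to the second degree u⁻¹g.
    conv_rhs => rw [← Equiv.sum_comp (Equiv.mulLeft u)]
    simp

/-- The braiding is c(a⊗b) = ∑ x·b⊗aₓ, and the terms with x outside G vanish. The multiplicativity
axiom for Δ sees the Yetter–Drinfeld structure only through c, so it carries over unchanged. -/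
theorem restrictYD_braiding [Finite Γ] {G : Subgroup Γ} (hG : D.IsSupportedOn G) :
    (restrictYD hG).braiding (restrictYD hG) = D.braiding D.toYetterDrinfeld := by
  classical
  have := Fintype.ofFinite Γ
  ext a b
  simp only [YetterDrinfeld.braiding, restrictYD, restrictCoact_apply, coact_eq,
    TensorProduct.AlgebraTensorModule.curry_apply, TensorProduct.curry_apply,
    LinearMap.coe_restrictScalars, LinearMap.comp_apply, LinearMap.rTensor_tmul,
    TensorProduct.sum_tmul, map_sum, LinearEquiv.coe_coe, TensorProduct.assoc_tmul,
    groupLift_single, one_smul, TensorProduct.comm_tmul, MonoidHom.comp_apply,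
    Subgroup.subtype_apply]
  exact sum_subgroup G (fun x => D.act x b ⊗ₜ[k] D.comp x a) fun x hx => by simp [hG x hx]

/-- The braided Hopf algebra over `kG` obtained by restriction. -/
def restrict [Finite Γ] {G : Subgroup Γ} (hG : D.IsSupportedOn G) : BraidedHopfAlgebra k G R where
  toYetterDrinfeld := restrictYD hG
  act_one x := D.act_one x
  coact_one := by
    classical
    have := Fintype.ofFinite Γ
    simp only [restrictYD, restrictCoact_apply, comp_one]
    rw [Finset.sum_eq_single 1]
    · simp [MonoidAlgebra.one_def]
    · intro b _ hb
      simp [hb]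
    · simp
  act_mul x := D.act_mul x
  coact_mul := by
    classical
    have := Fintype.ofFinite Γ
    ext r s
    simp only [TensorProduct.AlgebraTensorModule.curry_apply, TensorProduct.curry_apply,
      LinearMap.coe_restrictScalars, LinearMap.comp_apply, restrictYD_tensorCoact, map_sum,
      LinearMap.lTensor_tmul, TensorProduct.map_tmul, LinearMap.mul'_apply]
    simp only [restrictYD, restrictCoact_apply, comp_mul]
    refine Finset.sum_congr rfl fun g _ => ?_
    -- It is enough to restrict the degree of the first factor, since g lies in G and the second
    -- degree u⁻¹g then does too.
    rw [← sum_subgroup G _ fun x hx => by rw [hG x hx, zero_mul]]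
  counit_act x := D.counit_act x
  counit_coact r := by
    classical
    have := Fintype.ofFinite Γ
    simp only [restrictYD, restrictCoact_apply, map_sum, LinearMap.lTensor_tmul, counit_comp]
    rw [Finset.sum_eq_single 1]
    · simp [MonoidAlgebra.one_def]
    · intro b _ hb
      simp [hb]
    · simp
  comul_act x := D.comul_act x
  comul_coact := by
    classical
    have := Fintype.ofFinite Γ
    ext r
    simp only [LinearMap.comp_apply, restrictYD_tensorCoact]
    simp only [restrictYD, restrictCoact_apply, map_sum, LinearMap.lTensor_tmul, comul_comp]
    refine Finset.sum_congr rfl fun g _ => ?_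
    rw [← sum_subgroup G _ fun x hx => ?_]
    rw [show D.comp x = 0 from LinearMap.ext (hG x hx), TensorProduct.map_zero_left,
      LinearMap.zero_apply]
  counit_one := D.counit_one
  counit_mul := D.counit_mul
  comul_one := D.comul_one
  comul_mul := by
    rw [restrictYD_braiding]
    exact D.comul_mul
  antipode := D.antipode
  antipode_hom :=
    { map_act := fun x => D.antipode_hom.map_act x
      map_coact := by
        classical
        have := Fintype.ofFinite Γ
        ext r
        simp [restrictYD, restrictCoact_apply, antipode_comp] }
  antipode_left := D.antipode_left
  antipode_right := D.antipode_right

theorem isRestriction_restrict [Finite Γ] {G : Subgroup Γ} (hG : D.IsSupportedOn G) :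
    (restrict hG).IsRestriction D where
  act_eq _ := rfl
  coact_eq := by
    classical
    have := Fintype.ofFinite Γ
    ext r
    simp only [restrict, restrictYD, LinearMap.comp_apply, restrictCoact_apply, map_sum, coact_eq,
      LinearMap.rTensor_tmul]
    rw [← sum_subgroup G _ fun x hx => by rw [hG x hx, TensorProduct.tmul_zero]]
    simp
  antipode_eq := rfl

/-! ### The inclusion of bosonizations -/

namespace IsRestriction

variable {G : Subgroup Γ} {E : BraidedHopfAlgebra k G R}

theorem isSupportedOn (hE : E.IsRestriction D) : D.IsSupportedOn G := by
  classical
  intro x hx r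
  simp only [comp, LinearMap.comp_apply, hE.coact_eq]
  generalize E.coact r = z
  induction z using tensor_induction with
  | zero => simp
  | add a b ha hb => simp only [map_add, ha, hb, add_zero]
  | tmul y m =>
    have hy : (y : Γ) ≠ x := by
      rintro rfl
      exact hx y.2
    simp [hy]

theorem comp_eq (hE : E.IsRestriction D) (x : G) : E.comp x = D.comp (x : Γ) := by
  classical
  ext r
  simp only [comp, LinearMap.comp_apply, hE.coact_eq]
  generalize E.coact r = z
  induction z using tensor_induction with
  | zero => simp
  | add a b ha hb => simp only [map_add, ha, hb]
  | tmul y m =>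
    by_cases hy : y = x
    · simp [hy]
    · simp [hy, Subtype.coe_injective.ne hy]

/-- The inclusion `R # kG → R # kΓ`. -/
def incl [Finite Γ] (hE : E.IsRestriction D) : E.Bosonization →ₐc[k] D.Bosonization :=
  { E.bosonLift fun x => D.smash (x : Γ) with
    counit_comp := by
      ext x r
      simp [boson_counit_def, bosonCounit]
    map_comp_comul := by
      classical
      have := Fintype.ofFinite Γ
      ext x r
      simp only [LinearMap.comp_apply, boson_comul_def,
        bosonComul_smash, bosonLift_smash, hE.comp_eq]
      -- Δ on R#kΓ sums over degrees in Γ, Δ on R#kG over degrees in G; the additional terms contain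
      -- zero components.
      rw [← sum_subgroup G _ fun y hy => ?_]
      · generalize Coalgebra.comul (R := k) r = z
        induction z using TensorProduct.induction_on with
        | zero => simp
        | add a b ha hb => simp only [map_add, Finset.sum_add_distrib, ha, hb]
        | tmul a b => simp
      · rw [show D.comp y = 0 from LinearMap.ext (hE.isSupportedOn y hy), LinearMap.comp_zero,
          TensorProduct.map_zero_right, LinearMap.zero_apply]
    map_one' := by simp [boson_one_def]
    map_mul' := fun a b => by
      simp only [AddHom.toFun_eq_coe, LinearMap.coe_toAddHom]
      induction a using E.boson_induction with
      | zero => simp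
      | add a a' h h' => simp [add_mul, h, h']
      | smash x r =>
      induction b using E.boson_induction with
      | zero => simp
      | add a a' h h' => simp [mul_add, h, h']
      | smash y s => simp [hE.act_eq] }

@[simp]
theorem incl_smash [Finite Γ] (hE : E.IsRestriction D) (x : G) (r : R) :
    hE.incl (E.smash x r) = D.smash (x : Γ) r :=
  E.bosonLift_smash _ x r

theorem incl_injective [Finite Γ] (hE : E.IsRestriction D) : Function.Injective hE.incl := by
  -- On finitely supported functions the inclusion is extension by zero from G to Γ.
  have h : ∀ a, hE.incl a = Finsupp.mapDomain (M := R) (fun x : G => (x : Γ)) a := fun a => by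
    induction a using E.boson_induction with
    | zero => exact (map_zero hE.incl).trans Finsupp.mapDomain_zero.symm
    | add a b ha hb => rw [map_add, ha, hb]; exact Finsupp.mapDomain_add.symm
    | smash x r => rw [incl_smash]; exact Finsupp.mapDomain_single.symm
  intro a b hab
  rw [h, h] at hab
  exact Finsupp.mapDomain_injective Subtype.coe_injective hab

end IsRestriction

/-! ### The projection onto the group algebra of the quotient -/

variable (D) in
/-- The linear map `r # x ↦ ε(r) xG` from `R # kΓ` to `k(Γ/G)`. -/
def quotientLinearMap (G : Subgroup Γ) : D.Bosonization →ₗ[k] k[Γ ⧸ G] :=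
  D.bosonLift fun x => MonoidAlgebra.lsingle (x : Γ ⧸ G) ∘ₗ Coalgebra.counit (R := k) (A := R)

@[simp]
theorem quotientLinearMap_smash (G : Subgroup Γ) (x : Γ) (r : R) :
    D.quotientLinearMap G (D.smash x r) =
      MonoidAlgebra.single (x : Γ ⧸ G) (Coalgebra.counit (R := k) r) :=
  D.bosonLift_smash _ x r

section Quotient

variable [Finite Γ] {G : Subgroup Γ} [G.Normal] (hG : D.IsSupportedOn G)

include hG in
-- All degrees g occurring in the second tensor factor of Δ(r) lie in G, so each left leg falls in
-- the one coset gxG = xG. The components on the right then add up again, and the counit axiom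
-- returns r.
theorem quotientLinearMap_rTensor_comul (x : Γ) (r : R) :
    (D.quotientLinearMap G).rTensor D.Bosonization
      (Coalgebra.comul (R := k) (D.smash x r)) =
      MonoidAlgebra.single (x : Γ ⧸ G) 1 ⊗ₜ[k] D.smash x r := by
  classical
  have := Fintype.ofFinite Γ
  have h : ∀ z : R ⊗[k] R,
      (D.quotientLinearMap G).rTensor D.Bosonization
        (∑ g, TensorProduct.map (D.smash (g * x)) (D.smash x ∘ₗ D.comp g) z) =
      MonoidAlgebra.single (x : Γ ⧸ G) 1 ⊗ₜ[k]
        D.smash x (TensorProduct.lid k R ((Coalgebra.counit (R := k)).rTensor R z)) := by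
    intro z
    induction z using TensorProduct.induction_on with
    | zero => simp
    | add a b ha hb =>
      simp only [map_add, Finset.sum_add_distrib, ha, hb, TensorProduct.tmul_add]
    | tmul a b =>
      -- Either g lies in G, and normality gives gxG = xG, or the component of b in degree g is
      -- zero.
      have hg : ∀ g, MonoidAlgebra.single ((g * x : Γ) : Γ ⧸ G) (Coalgebra.counit (R := k) a) ⊗ₜ[k]
          D.smash x (D.comp g b) = MonoidAlgebra.single (x : Γ ⧸ G) (1 : k) ⊗ₜ[k]
            (Coalgebra.counit (R := k) a • D.smash x (D.comp g b)) := by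
        intro g
        by_cases hg : g ∈ G
        · rw [QuotientGroup.mk_mul, (QuotientGroup.eq_one_iff g).2 hg, one_mul,
            ← TensorProduct.smul_tmul]
          simp
        · simp [hG g hg]
      simp only [map_sum, TensorProduct.map_tmul, LinearMap.comp_apply, LinearMap.rTensor_tmul]
      simp only [quotientLinearMap_smash, hg]
      rw [← TensorProduct.tmul_sum, ← Finset.smul_sum, ← map_sum, sum_comp]
      simp
  rw [boson_comul_def, bosonComul_smash, h]
  simp

omit [G.Normal] in
-- The counit kills every degree except 1, so only the term g = 1 survives and its left leg has
-- group part x.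
theorem quotientLinearMap_lTensor_comul (x : Γ) (r : R) :
    (D.quotientLinearMap G).lTensor D.Bosonization
      (Coalgebra.comul (R := k) (D.smash x r)) =
      D.smash x r ⊗ₜ[k] MonoidAlgebra.single (x : Γ ⧸ G) 1 := by
  classical
  have := Fintype.ofFinite Γ
  have h : ∀ z : R ⊗[k] R,
      (D.quotientLinearMap G).lTensor D.Bosonization
        (∑ g, TensorProduct.map (D.smash (g * x)) (D.smash x ∘ₗ D.comp g) z) =
      D.smash x (TensorProduct.rid k R ((Coalgebra.counit (R := k)).lTensor R z)) ⊗ₜ[k]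
        MonoidAlgebra.single (x : Γ ⧸ G) 1 := by
    intro z
    induction z using TensorProduct.induction_on with
    | zero => simp
    | add a b ha hb =>
      simp only [map_add, Finset.sum_add_distrib, ha, hb, TensorProduct.add_tmul]
    | tmul a b =>
      simp only [map_sum, TensorProduct.map_tmul, LinearMap.comp_apply, LinearMap.lTensor_tmul]
      simp only [quotientLinearMap_smash, counit_comp]
      rw [Finset.sum_eq_single 1]
      · simp [TensorProduct.smul_tmul]
      · intro b _ hb
        simp [hb]
      · simp
  rw [boson_comul_def, bosonComul_smash, h]
  simp

variable (D G) in
/-- The projection `R # kΓ → k(Γ/G)`. -/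
def quotientMap : D.Bosonization →ₐc[k] k[Γ ⧸ G] :=
  { D.quotientLinearMap G with
    counit_comp := by
      ext x r
      simp [boson_counit_def, bosonCounit]
    map_comp_comul := by
      ext x r
      -- Writing π⊗π as (id⊗π)(π⊗id) reduces comultiplicativity to the formula for the left leg:
      -- both sides are ε(r) xG⊗xG.
      have h : TensorProduct.map (D.quotientLinearMap G) (D.quotientLinearMap G)
          (Coalgebra.comul (R := k) (D.smash x r)) =
          (D.quotientLinearMap G).lTensor _ ((D.quotientLinearMap G).rTensor _
            (Coalgebra.comul (R := k) (D.smash x r))) := by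
        exact (LinearMap.congr_fun (LinearMap.lTensor_comp_rTensor ..) _).symm
      refine h.trans ?_
      rw [quotientLinearMap_rTensor_comul hG]
      simp
    map_one' := by simp [boson_one_def, D.counit_one, MonoidAlgebra.one_def]
    map_mul' := fun a b => by
      simp only [AddHom.toFun_eq_coe, LinearMap.coe_toAddHom]
      induction a using D.boson_induction with
      | zero => simp
      | add a a' h h' => simp [add_mul, h, h']
      | smash x r =>
      induction b using D.boson_induction with
      | zero => simp
      | add a a' h h' => simp [mul_add, h, h']
      | smash y s => simp [D.counit_mul, D.counit_act] }

@[simp]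
theorem quotientMap_smash (x : Γ) (r : R) : D.quotientMap G hG (D.smash x r) =
    MonoidAlgebra.single (x : Γ ⧸ G) (Coalgebra.counit (R := k) r) :=
  D.bosonLift_smash _ x r

theorem quotientMap_surjective : Function.Surjective (D.quotientMap G hG) := by
  intro c
  induction c using MonoidAlgebra.induction_linear with
  | zero => exact ⟨0, map_zero _⟩
  | add a b ha hb =>
    obtain ⟨a, rfl⟩ := ha
    obtain ⟨b, rfl⟩ := hb
    exact ⟨a + b, map_add _ _ _⟩
  | single x a =>
    obtain ⟨x, rfl⟩ := QuotientGroup.mk_surjective x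
    exact ⟨D.smash x (a • 1), by simp [D.counit_one]⟩

variable {E : BraidedHopfAlgebra k G R} (hE : E.IsRestriction D)

theorem quotientMap_incl (a : E.Bosonization) : D.quotientMap G hG (hE.incl a) =
    algebraMap k k[Γ ⧸ G] (Coalgebra.counit (R := k) a) := by
  induction a using E.boson_induction with
  | zero => simp
  | add a b ha hb => simp only [map_add, ha, hb]
  | smash x r =>
    simp [boson_counit_def, bosonCounit, (QuotientGroup.eq_one_iff (x : Γ)).2 x.2]

/-! ### The kernel of the projection -/

variable (D) in
/-- The section `xG ↦ 1 # x` of the projection `R # kΓ → k(Γ/G)` given by representatives. -/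
def quotientSection (G : Subgroup Γ) : k[Γ ⧸ G] →ₗ[k] D.Bosonization :=
  (Finsupp.linearCombination k fun c : Γ ⧸ G => D.smash c.out 1) ∘ₗ
    (MonoidAlgebra.coeffLinearEquiv k).toLinearMap

omit [Finite Γ] [G.Normal] in
theorem quotientSection_single (c : Γ ⧸ G) (a : k) :
    D.quotientSection G (MonoidAlgebra.single c a) = a • D.smash c.out 1 := by
  simp [quotientSection]

/-- Taking I to be only a subspace lets one argument serve BA⁺ and A⁺B. When π(b) = 0 the conclusion
reads b ∈ I. -/
theorem sub_quotientSection_mem (I : Submodule k D.Bosonization)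
    (hI : ∀ x y : Γ, (x : Γ ⧸ G) = y → D.smash x 1 - D.smash y 1 ∈ I)
    (hI' : ∀ (x : Γ) (r : R), Coalgebra.counit (R := k) r = 0 → D.smash x r ∈ I)
    (b : D.Bosonization) : b - D.quotientSection G (D.quotientMap G hG b) ∈ I := by
  induction b using D.boson_induction with
  | zero => simp
  | add a b ha hb => simpa only [map_add, add_sub_add_comm] using I.add_mem ha hb
  | smash x r =>
    set e := Coalgebra.counit (R := k) r with he
    -- Split r as (r − ε(r)1) + ε(r)1: the first part has counit zero, the second only changes the
    -- coset representative.
    rw [quotientMap_smash, quotientSection_single, ← he,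
      show D.smash x r - e • D.smash (x : Γ ⧸ G).out 1 =
        D.smash x (r - e • 1) + e • (D.smash x 1 - D.smash (x : Γ ⧸ G).out 1) by
      simp only [map_sub, map_smul, smul_sub]; abel]
    exact I.add_mem (hI' _ _ (by simp [D.counit_one, he]))
      (I.smul_mem _ (hI _ _ (QuotientGroup.out_eq' _).symm))

theorem ker_quotientMap_eq_left :
    LinearMap.ker (D.quotientMap G hG : D.Bosonization →ₗ[k] k[Γ ⧸ G]) =
      Submodule.span k {c | ∃ (b : D.Bosonization) (a : E.Bosonization),
        Coalgebra.counit (R := k) a = 0 ∧ c = b * hE.incl a} := by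
  refine le_antisymm (fun b hb => ?_) (Submodule.span_le.2 ?_)
  · have hb : D.quotientMap G hG b = 0 := hb
    -- The factorizations are 1#x − 1#y = (1#y)(1#y⁻¹x − 1) and r#x = (1#x)(x⁻¹·r#1).
    have := sub_quotientSection_mem hG (Submodule.span k {c | ∃ (b : D.Bosonization)
      (a : E.Bosonization), Coalgebra.counit (R := k) a = 0 ∧ c = b * hE.incl a})
      (fun x y hxy => Submodule.subset_span ⟨D.smash y 1,
        E.smash ⟨y⁻¹ * x, QuotientGroup.eq.1 hxy.symm⟩ 1 - 1, ?_, ?_⟩)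
      (fun x r hr => Submodule.subset_span ⟨D.smash x 1, E.smash 1 (D.act x⁻¹ r), ?_, ?_⟩) b
    · rwa [hb, map_zero, sub_zero] at this
    · simp [boson_counit_def, bosonCounit, boson_one_def, D.counit_one]
    · simp [mul_sub, D.act_one]
    · simp [boson_counit_def, bosonCounit, D.counit_act, hr]
    · simp
  · rintro _ ⟨b, a, ha, rfl⟩
    change D.quotientMap G hG (b * hE.incl a) = 0
    rw [map_mul, quotientMap_incl, ha, map_zero, mul_zero]

theorem ker_quotientMap_eq_right :
    LinearMap.ker (D.quotientMap G hG : D.Bosonization →ₗ[k] k[Γ ⧸ G]) =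
      Submodule.span k {c | ∃ (b : D.Bosonization) (a : E.Bosonization),
        Coalgebra.counit (R := k) a = 0 ∧ c = hE.incl a * b} := by
  refine le_antisymm (fun b hb => ?_) (Submodule.span_le.2 ?_)
  · have hb : D.quotientMap G hG b = 0 := hb
    -- Here 1#x − 1#y = (1#xy⁻¹ − 1)(1#y) and r#x = (r#1)(1#x); normality puts xy⁻¹ in G.
    have := sub_quotientSection_mem hG (Submodule.span k {c | ∃ (b : D.Bosonization)
      (a : E.Bosonization), Coalgebra.counit (R := k) a = 0 ∧ c = hE.incl a * b})
      (fun x y hxy => Submodule.subset_span ⟨D.smash y 1,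
        E.smash ⟨x * y⁻¹, ?_⟩ 1 - 1, ?_, ?_⟩)
      (fun x r hr => Submodule.subset_span ⟨D.smash x 1, E.smash 1 r, ?_, ?_⟩) b
    · rwa [hb, map_zero, sub_zero] at this
    · rw [← QuotientGroup.eq_one_iff, QuotientGroup.mk_mul, hxy, ← QuotientGroup.mk_mul,
        mul_inv_cancel, QuotientGroup.mk_one]
    · simp [boson_counit_def, bosonCounit, boson_one_def, D.counit_one]
    · simp [sub_mul, D.act_one]
    · simp [boson_counit_def, bosonCounit, hr]
    · simp
  · rintro _ ⟨b, a, ha, rfl⟩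
    change D.quotientMap G hG (hE.incl a * b) = 0
    rw [map_mul, quotientMap_incl, ha, map_zero, zero_mul]

/-! ### Coinvariants -/

omit [G.Normal] in
theorem smash_mem_range_incl {x : Γ} (hx : x ∈ G) (r : R) :
    D.smash x r ∈ LinearMap.range (hE.incl : E.Bosonization →ₗ[k] D.Bosonization) :=
  ⟨E.smash ⟨x, hx⟩ r, hE.incl_smash _ r⟩

theorem coe_quotientMap : (D.quotientMap G hG : D.Bosonization →ₗ[k] k[Γ ⧸ G]) =
    D.quotientLinearMap G := rfl

theorem mem_range_incl_iff_left (b : D.Bosonization) : b ∈ Set.range hE.incl ↔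
    (D.quotientMap G hG : D.Bosonization →ₗ[k] k[Γ ⧸ G]).rTensor D.Bosonization
      (Coalgebra.comul (R := k) b) = 1 ⊗ₜ[k] b := by
  classical
  constructor
  · rintro ⟨a, rfl⟩
    induction a using E.boson_induction with
    | zero => simp
    | add a b ha hb => simp only [map_add, TensorProduct.tmul_add, ha, hb]
    | smash x r =>
      rw [hE.incl_smash, coe_quotientMap, quotientLinearMap_rTensor_comul hG,
        (QuotientGroup.eq_one_iff (x : Γ)).2 x.2,
        MonoidAlgebra.one_def]
  · intro h
    -- T reads off the coefficient of the trivial coset. Applied to (π⊗id)Δ(b) it keeps the summands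
    -- R#x with x in G, hence lands in A; applied to 1⊗b it gives b.
    let T : k[Γ ⧸ G] ⊗[k] D.Bosonization →ₗ[k] D.Bosonization :=
      groupLift fun c => if c = 1 then LinearMap.id else 0
    have hT : ∀ b, T ((D.quotientMap G hG : D.Bosonization →ₗ[k] k[Γ ⧸ G]).rTensor D.Bosonization
        (Coalgebra.comul (R := k) b)) ∈
        LinearMap.range (hE.incl : E.Bosonization →ₗ[k] D.Bosonization) := by
      intro b
      induction b using D.boson_induction with
      | zero => simp
      | add a b ha hb => simpa only [map_add] using Submodule.add_mem _ ha hb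
      | smash x r =>
        rw [coe_quotientMap, quotientLinearMap_rTensor_comul hG]
        by_cases hx : x ∈ G
        · simpa [T, (QuotientGroup.eq_one_iff x).2 hx] using smash_mem_range_incl hE hx r
        · simp [T, (QuotientGroup.eq_one_iff x).not.2 hx]
    have := hT b
    rw [h] at this
    simpa [T, MonoidAlgebra.one_def] using this

/-- The two formulas attach the same coset to r#x, so the flip exchanges (id⊗π)Δ and (π⊗id)Δ, and
right coinvariance is left coinvariance. -/
theorem mem_range_incl_iff_right (b : D.Bosonization) : b ∈ Set.range hE.incl ↔
    (D.quotientMap G hG : D.Bosonization →ₗ[k] k[Γ ⧸ G]).lTensor D.Bosonization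
      (Coalgebra.comul (R := k) b) = b ⊗ₜ[k] 1 := by
  have h : TensorProduct.comm k D.Bosonization k[Γ ⧸ G]
      ((D.quotientMap G hG : D.Bosonization →ₗ[k] k[Γ ⧸ G]).lTensor D.Bosonization
        (Coalgebra.comul (R := k) b)) =
      (D.quotientMap G hG : D.Bosonization →ₗ[k] k[Γ ⧸ G]).rTensor D.Bosonization
        (Coalgebra.comul (R := k) b) := by
    induction b using D.boson_induction with
    | zero => simp
    | add a b ha hb => simp only [map_add, ha, hb]
    | smash x r =>
      rw [coe_quotientMap, quotientLinearMap_rTensor_comul hG, quotientLinearMap_lTensor_comul,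
        TensorProduct.comm_tmul]
  rw [mem_range_incl_iff_left hG, ← h, ← TensorProduct.comm_tmul, EquivLike.apply_eq_iff_eq]

theorem isExactHopfSequence_incl_quotientMap :
    IsExactHopfSequence hE.incl (D.quotientMap G hG) where
  injective := hE.incl_injective
  surjective := quotientMap_surjective hG
  ker_eq_left := ker_quotientMap_eq_left hG hE
  ker_eq_right := ker_quotientMap_eq_right hG hE
  range_eq_left := mem_range_incl_iff_left hG hE
  range_eq_right := mem_range_incl_iff_right hG hE

end Quotient

end BraidedHopfAlgebra

end BraidedHopf
end

theorem mainTheorem8 {k Γ R V : Type*} [Field k] [Group Γ] [Finite Γ]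
    [Ring R] [Algebra k R] [Coalgebra k R] [AddCommGroup V] [Module k V]
    (D : BraidedHopf.BraidedHopfAlgebra k Γ R) (hD : D.IsETAlgebra)
    (g : Γ) (ρ : Representation k (BraidedHopf.isotropy g) V) (hρ : ρ.IsIrreducible)
    (hP : ∃ φ : BraidedHopf.IndSpace g ρ →ₗ[k] R, Function.Injective φ ∧
      (BraidedHopf.inducedYD g ρ).IsHom D.toYetterDrinfeld φ ∧
      LinearMap.range φ = BraidedHopf.primitives k R) :
    ∃ E : BraidedHopf.BraidedHopfAlgebra k (BraidedHopf.conjSubgroup g) R, E.IsRestriction D ∧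
      ∃ (ι : E.Bosonization →ₐc[k] D.Bosonization)
        (π : D.Bosonization →ₐc[k] MonoidAlgebra k (Γ ⧸ BraidedHopf.conjSubgroup g)),
        (∀ (x : BraidedHopf.conjSubgroup g) (r : R), ι (E.smash x r) = D.smash (x : Γ) r) ∧
        (∀ (x : Γ) (r : R), π (D.smash x r) =
          MonoidAlgebra.single (x : Γ ⧸ BraidedHopf.conjSubgroup g)
            (Coalgebra.counit (R := k) r)) ∧
        BraidedHopf.IsExactHopfSequence ι π := by
  obtain ⟨φ, -, hφ, hφP⟩ := hP
  have hG := BraidedHopf.BraidedHopfAlgebra.isSupportedOn_conjSubgroup hD hφ hφP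
  have hE := BraidedHopf.BraidedHopfAlgebra.isRestriction_restrict hG
  -- The type of `hE` determines the first witness as `restrict hG`.
  exact ⟨_, hE, hE.incl, D.quotientMap _ hG, hE.incl_smash,
    BraidedHopf.BraidedHopfAlgebra.quotientMap_smash hG,
    BraidedHopf.BraidedHopfAlgebra.isExactHopfSequence_incl_quotientMap hG hE⟩
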